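/- All trees below are rooted trees with vertex set $[n]=\{1,\dots,n\}$. A vertex $j$ is a *descendant* of a vertex $i$ if the path from the root to $j$ passes through $i$ (so every vertex is a descendant of itself); if moreover $i$ and $j$ are joined by an edge, then $j$ is a *child* of $i$. Let $\beta_T(i)$ be the smallest descendant of $i$ in the tree $T$. A *plane tree* on $[n]$ is a rooted tree with vertex set $[n]$ in which the children of each vertex are linearly ordered from left to right. A vertex $j$ of a plane tree $T$ is *elder* if there is a vertex $k$, a child of the same vertex as $j$ and to the right of $j$, such that $\beta_T(k)<\beta_T(j)$; otherwise $j$ is *younger*. Let $\mathrm{eld}(T)$ be the number of elder vertices of $T$, and let $\mathrm{young}_T(v)$ be the number of younger children of the vertex $v$. An edge $(i,j)$ of $T$, where $j$ is a child of $i$, is *improper* if $j$ is younger and $\beta_T(j)\le i$. Let $\mathcal P_{n,0}$ be the set of plane trees on $[n]$ with no improper edges. A tree (or plane tree) is *increasing* if the labels along the path from the root to any vertex form an increasing sequence. **Proposition.** For every $n\ge 1$, $$\sum_{T\in\mathcal P_{n,0}}x^{\mathrm{young}_T(1)}\,t^{\mathrm{eld}(T)}=\prod_{k=0}^{n-2}(x+k+kt).$$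 In particular, the number of increasing trees on $[n]$ is $(n-1)!$, and the number of increasing plane trees on $[n]$ is $(2n-3)!!$, with the convention $(-1)!!=1$. -/

import Mathlib

/-- A rooted labeled tree with vertex set `V`: a tree, in the sense of graph theory, together with
a distinguished vertex, the root. Two such trees are equal when they have the same edges and the
same root. -/
@[ext]
structure RootedLabeledTree (V : Type*) where
  /-- The underlying graph. -/
  graph : SimpleGraph V
  isTree : graph.IsTree
  /-- The root. -/
  root : V

namespace RootedLabeledTree

variable {V : Type*}

/-- `j` is a descendant of `i`: the path from the root to `j` passes through `i`. -/
def IsDescendant (T : RootedLabeledTree V) (i j : V) : Prop :=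
  ∃ p : T.graph.Walk T.root j, p.IsPath ∧ i ∈ p.support

/-- `j` is a child of `i`: it is a descendant of `i` and is joined to `i` by an edge. -/
def IsChild (T : RootedLabeledTree V) (i j : V) : Prop :=
  T.graph.Adj i j ∧ T.IsDescendant i j

/-- Each vertex is a descendant of itself. -/
theorem isDescendant_self (T : RootedLabeledTree V) (i : V) : T.IsDescendant i i := by
  obtain ⟨p, hp⟩ := T.isTree.connected.exists_isPath T.root i
  exact ⟨p, hp, p.end_mem_support⟩

open Classical in
/-- The finite set of all descendants of `i`. -/
noncomputable def descendants [Fintype V] (T : RootedLabeledTree V) (i : V) : Finset V :=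
  Finset.univ.filter fun j => T.IsDescendant i j

theorem descendants_nonempty [Fintype V] (T : RootedLabeledTree V) (i : V) :
    (T.descendants i).Nonempty :=
  ⟨i, by simp [descendants, T.isDescendant_self i]⟩

/-- The smallest descendant of `i`. -/
noncomputable def beta [Fintype V] [LinearOrder V] (T : RootedLabeledTree V) (i : V) : V :=
  (T.descendants i).min' (T.descendants_nonempty i)

/-- A tree is increasing if any path from the root to another vertex forms an increasing
sequence. -/
def IsIncreasing [LinearOrder V] (T : RootedLabeledTree V) : Prop :=
  ∀ (v : V) (p : T.graph.Walk T.root v), p.IsPath → p.support.Pairwise (· < ·)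

instance [Finite V] : Finite (RootedLabeledTree V) :=
  Finite.of_injective (fun T : RootedLabeledTree V => (T.graph, T.root)) fun S T h => by
    simp only [Prod.mk.injEq] at h
    exact RootedLabeledTree.ext h.1 h.2

end RootedLabeledTree

/-- A (labeled) plane tree with vertex set `V`: a rooted labeled tree in which the children of each
vertex are linearly ordered. The order is recorded by listing, without repetition, the children of
each vertex `v` from left to right. -/
@[ext]
structure PlaneTree (V : Type*) extends RootedLabeledTree V where
  /-- The children of a vertex, from left to right. -/
  children : V → List V
  nodup_children : ∀ i, (children i).Nodup
  mem_children : ∀ i j, j ∈ children i ↔ toRootedLabeledTree.IsChild i j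

namespace PlaneTree

variable {V : Type*}

/-- `k` is a brother of `j` to its right: both are children of the same vertex, and `j` comes
before `k` in the list of children of that vertex. -/
def IsRightBrother (T : PlaneTree V) (j k : V) : Prop :=
  ∃ i, [j, k].Sublist (T.children i)

variable [Fintype V] [LinearOrder V]

/-- A vertex `j` is elder if it has a brother `k` to its right whose smallest descendant is smaller
than the smallest descendant of `j`; otherwise `j` is younger. -/
def IsElder (T : PlaneTree V) (j : V) : Prop :=
  ∃ k, T.IsRightBrother j k ∧ T.beta k < T.beta j

/-- The number of elder vertices of `T`. -/
noncomputable def eld (T : PlaneTree V) : ℕ :=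
  {j : V | T.IsElder j}.ncard

/-- The number of younger children of the vertex `v`. -/
noncomputable def young (T : PlaneTree V) (v : V) : ℕ :=
  {j : V | T.IsChild v j ∧ ¬ T.IsElder j}.ncard

/-- The edge `(i, j)`, with `j` a child of `i`, is proper if `j` is elder or `i` is smaller than
the smallest descendant of `j`; otherwise it is improper. -/
def IsImproperEdge (T : PlaneTree V) (i j : V) : Prop :=
  T.IsChild i j ∧ ¬ (T.IsElder j ∨ i < T.beta j)

/-- The number of improper edges of `T`. -/
noncomputable def imp (T : PlaneTree V) : ℕ :=
  {e : V × V | T.IsImproperEdge e.1 e.2}.ncard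

instance : Finite (PlaneTree V) :=
  Finite.of_injective
    (fun T : PlaneTree V => (T.toRootedLabeledTree,
      fun i => (⟨T.children i, T.nodup_children i⟩ : {l : List V // l.Nodup})))
    fun S T h => by
      simp only [Prod.mk.injEq] at h
      have h2 : S.children = T.children := by
        funext i
        exact congrArg Subtype.val (congrFun h.2 i)
      cases S; cases T
      simp_all

noncomputable instance : Fintype (PlaneTree V) := Fintype.ofFinite _

end PlaneTree

/-- The set of plane trees on `n` labels with exactly `k` improper edges. The label set
`{1, …, n}` is represented by `Fin n`, label `m` being the element with value `m - 1`. -/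
noncomputable def planeTrees (n k : ℕ) : Finset (PlaneTree (Fin n)) :=
  Finset.univ.filter fun T => T.imp = k

/-! ### Parents, children and increasing labels in rooted trees. -/

namespace RootedLabeledTree

variable {V : Type*}

/-! A plane tree has no improper edge exactly when it is increasing: among the children of `i`, the
one with the smallest `beta` is younger, so properness of its edge puts `i` below every descendant
of every child (`imp_eq_zero_iff`). In an increasing tree `beta` is the identity, so elder vertices
can be read off the lists of children.

Increasing plane trees grow by adding the largest label as a leaf, at any position among the
children of any vertex. No other vertex changes status. The new leaf is elder (factor `t`) unless it
is placed last; placed last it is younger, with factor `x` below the smallest label and 1 elsewhere.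
A tree with `k` edges has `k` non-last positions and `k + 1` last ones, exactly one of them below
the root, so the factor is `x + k + k * t` (`childListsWeight_insertLeaf`,
`sum_length_of_mem_childLists`, `sum_childListsWeight`).

Setting `x = t = 1` counts increasing plane trees. Setting `x = 1`, `t = 0` keeps those with sorted
lists of children, one for each increasing tree. -/

theorem path_unique (T : RootedLabeledTree V) {u v : V} {p q : T.graph.Walk u v}
    (hp : p.IsPath) (hq : q.IsPath) : p = q :=
  (T.isTree.existsUnique_path u v).unique hp hq

theorem IsChild.penultimate_eq {T : RootedLabeledTree V} {i j : V} (h : T.IsChild i j)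
    {p : T.graph.Walk T.root j} (hp : p.IsPath) : p.penultimate = i := by
  classical
  obtain ⟨hadj, q, hq, hi⟩ := h
  obtain rfl := T.path_unique hp hq
  have hj : j ∉ (p.takeUntil i hi).support :=
    SimpleGraph.Walk.endpoint_notMem_support_takeUntil hp hi hadj.ne'
  have := T.path_unique hp ((hp.takeUntil hi).concat hj hadj)
  rw [this, SimpleGraph.Walk.penultimate_concat]

theorem IsChild.parent_unique {T : RootedLabeledTree V} {i i' j : V} (h : T.IsChild i j)
    (h' : T.IsChild i' j) : i = i' := by
  obtain ⟨-, p, hp, -⟩ := id h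
  rw [← h.penultimate_eq hp, ← h'.penultimate_eq hp]

theorem not_isChild_root (T : RootedLabeledTree V) (i : V) : ¬ T.IsChild i T.root := by
  rintro ⟨hadj, p, hp, hi⟩
  obtain rfl := (SimpleGraph.Walk.isPath_iff_nil.1 hp).eq_nil
  exact hadj.ne (by simpa using hi)

theorem isChild_penultimate {T : RootedLabeledTree V} {j : V} {p : T.graph.Walk T.root j}
    (hp : p.IsPath) (hn : ¬ p.Nil) : T.IsChild p.penultimate j :=
  ⟨p.adj_penultimate hn, p, hp, p.getVert_mem_support _⟩

theorem exists_isChild (T : RootedLabeledTree V) {j : V} (hj : j ≠ T.root) :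
    ∃ i, T.IsChild i j := by
  obtain ⟨p, hp⟩ := T.isTree.connected.exists_isPath T.root j
  exact ⟨_, isChild_penultimate hp (SimpleGraph.Walk.not_nil_of_ne hj.symm)⟩

/-- The path to `j` either meets `i`, or extends along the edge to a path to `i` through `j`. -/
theorem adj_iff (T : RootedLabeledTree V) {i j : V} :
    T.graph.Adj i j ↔ T.IsChild i j ∨ T.IsChild j i := by
  refine ⟨fun h => ?_, fun h => h.elim (·.1) (·.1.symm)⟩
  obtain ⟨p, hp⟩ := T.isTree.connected.exists_isPath T.root j
  by_cases hi : i ∈ p.support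
  · exact .inl ⟨h, p, hp, hi⟩
  · refine .inr ⟨h.symm, p.concat h.symm, hp.concat hi h.symm, ?_⟩
    rw [SimpleGraph.Walk.support_concat]
    simp

/-- A rooted tree is determined by its child relation. -/
theorem ext_isChild {S T : RootedLabeledTree V} (h : ∀ i j, S.IsChild i j ↔ T.IsChild i j) :
    S = T := by
  apply RootedLabeledTree.ext
  · ext i j
    rw [adj_iff, adj_iff, h, h]
  · by_contra hr
    obtain ⟨i, hi⟩ := T.exists_isChild hr
    exact S.not_isChild_root i ((h _ _).2 hi)

theorem mem_descendants [Fintype V] (T : RootedLabeledTree V) {i j : V} :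
    j ∈ T.descendants i ↔ T.IsDescendant i j := by
  simp [descendants]

section LinearOrder

variable [LinearOrder V]

theorem _root_.SimpleGraph.Walk.le_end_of_pairwise {G : SimpleGraph V} {u v : V} (p : G.Walk u v)
    (hp : p.support.Pairwise (· < ·)) {i : V} (hi : i ∈ p.support) : i ≤ v := by
  rw [← p.dropLast_support_concat, List.pairwise_append] at hp
  rw [← p.dropLast_support_concat, List.mem_append, List.mem_singleton] at hi
  rcases hi with hi | rfl
  · exact (hp.2.2 i hi v (by simp)).le
  · exact le_rfl

theorem IsIncreasing.le_of_isDescendant {T : RootedLabeledTree V} (hT : T.IsIncreasing) {i j : V}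
    (h : T.IsDescendant i j) : i ≤ j := by
  obtain ⟨p, hp, hi⟩ := h
  exact p.le_end_of_pairwise (hT j p hp) hi

theorem IsIncreasing.lt_of_isChild {T : RootedLabeledTree V} (hT : T.IsIncreasing) {i j : V}
    (h : T.IsChild i j) : i < j :=
  lt_of_le_of_ne (hT.le_of_isDescendant h.2) h.1.ne

theorem isIncreasing_of_lt_of_isChild {T : RootedLabeledTree V}
    (h : ∀ i j, T.IsChild i j → i < j) : T.IsIncreasing := by
  suffices ∀ (u v : V) (p : T.graph.Walk u v), u = T.root → p.IsPath →
      p.support.Pairwise (· < ·) from fun v p hp => this _ v p rfl hp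
  intro u v p
  induction p using SimpleGraph.Walk.concatRec with
  | Hnil => simp
  | Hconcat p hadj ih =>
    rintro rfl hp
    have hp' := (SimpleGraph.Walk.concat_isPath_iff hadj).1 hp
    have ih := ih rfl hp'.1
    rw [SimpleGraph.Walk.support_concat, List.pairwise_append]
    refine ⟨ih, by simp, fun a ha b hb => ?_⟩
    rw [List.mem_singleton] at hb
    subst hb
    refine (p.le_end_of_pairwise ih ha).trans_lt (h _ _ ?_)
    have := isChild_penultimate hp (by simp [SimpleGraph.Walk.concat_eq_append])
    rwa [SimpleGraph.Walk.penultimate_concat] at this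

variable [Fintype V]

theorem beta_le (T : RootedLabeledTree V) (i : V) : T.beta i ≤ i :=
  Finset.min'_le _ _ (T.mem_descendants.2 (T.isDescendant_self i))

theorem IsIncreasing.beta_eq {T : RootedLabeledTree V} (hT : T.IsIncreasing) (i : V) :
    T.beta i = i :=
  le_antisymm (T.beta_le i) <| Finset.le_min' _ _ _ fun _ hj =>
    hT.le_of_isDescendant (T.mem_descendants.1 hj)

end LinearOrder

/-- A relation along which labels increase, and under which each element except `o` has exactly
one predecessor and `o` has none, is the child relation of a rooted tree. -/
theorem exists_isChild_iff [Finite V] [LinearOrder V] (o : V) (C : V → V → Prop)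
    (hlt : ∀ i j, C i j → i < j) (ho : ∀ i, ¬ C i o)
    (hex : ∀ j, j ≠ o → ∃! i, C i j) :
    ∃ T : RootedLabeledTree V, ∀ i j, T.IsChild i j ↔ C i j := by
  classical
  let G : SimpleGraph V :=
    { Adj := fun i j => C i j ∨ C j i
      symm := ⟨fun i j h => h.symm⟩
      loopless := ⟨fun i h => h.elim (fun h => (hlt _ _ h).ne rfl) (fun h => (hlt _ _ h).ne rfl)⟩ }
  -- Following predecessors downwards gives an increasing walk from `o`, hence a path, which visits
  -- the predecessor of its endpoint.
  have hwalk : ∀ j, ∃ p : G.Walk o j, p.support.Pairwise (· < ·) ∧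
      ∀ i, C i j → i ∈ p.support := by
    intro j
    induction j using (Finite.to_wellFoundedLT (α := V)).wf.induction with
    | _ j ih =>
      by_cases hj : j = o
      · subst hj
        exact ⟨.nil, by simp, fun i hi => (ho i hi).elim⟩
      · obtain ⟨i, hi, hu⟩ := hex j hj
        obtain ⟨p, hp, -⟩ := ih i (hlt _ _ hi)
        have hadj : G.Adj i j := .inl hi
        refine ⟨p.concat hadj, ?_, fun i' hi' => ?_⟩
        · rw [SimpleGraph.Walk.support_concat, List.pairwise_append]
          refine ⟨hp, by simp, fun a ha b hb => ?_⟩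
          rw [List.mem_singleton] at hb
          exact hb ▸ (p.le_end_of_pairwise hp ha).trans_lt (hlt _ _ hi)
        · rw [hu i' hi', SimpleGraph.Walk.support_concat]
          simp
  have hconn : G.Connected := by
    have : Nonempty V := ⟨o⟩
    refine ⟨fun u v => ?_⟩
    obtain ⟨p, -⟩ := hwalk u
    obtain ⟨q, -⟩ := hwalk v
    exact (p.reachable.symm).trans q.reachable
  have htree : G.IsTree := by
    rw [SimpleGraph.isTree_iff_connected_and_card]
    refine ⟨hconn, le_antisymm ?_ hconn.card_vert_le_card_edgeSet_add_one⟩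
    choose! par hpar hu using hex
    -- Each edge joins some `j ≠ o` to its predecessor, so there are fewer edges than vertices; a
    -- connected graph with this property is a tree.
    have hsub : G.edgeSet ⊆ (fun j => s(par j, j)) '' {o}ᶜ := by
      intro e
      induction e using Sym2.ind with
      | _ i j =>
        have key : ∀ i j, C i j → s(i, j) ∈ (fun j => s(par j, j)) '' {o}ᶜ := by
          intro i j h
          have hj : j ≠ o := fun hj => ho i (hj ▸ h)
          exact ⟨j, hj, by rw [hu j hj i h]⟩
        rintro (h | h)
        · exact key _ _ h
        · rw [Sym2.eq_swap]
          exact key _ _ h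
    have h1 := (Set.ncard_le_ncard hsub (Set.toFinite _)).trans (Set.ncard_image_le (Set.toFinite _))
    have h2 := Set.ncard_add_ncard_compl ({o} : Set V)
    rw [Set.ncard_singleton] at h2
    rw [Nat.card_coe_set_eq]
    omega
  refine ⟨⟨G, htree, o⟩, fun i j => ⟨?_, fun h => ?_⟩⟩
  · rintro ⟨h | h, p, hp, hi⟩
    · exact h
    · obtain ⟨q, hq, -⟩ := hwalk j
      have hpq : p = q := (htree.existsUnique_path o j).unique hp
        ((SimpleGraph.Walk.isPath_def _).2 (hq.imp ne_of_lt))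
      exact absurd (q.le_end_of_pairwise hq (hpq ▸ hi)) (hlt _ _ h).not_ge
  · obtain ⟨q, hq, hm⟩ := hwalk j
    exact ⟨.inl h, q, (SimpleGraph.Walk.isPath_def _).2 (hq.imp ne_of_lt), hm i h⟩

end RootedLabeledTree

/-! ### Elder entries of a list. -/

namespace List

variable {α : Type*} [LinearOrder α]

/-- The number of entries of a list that are followed by a smaller entry. -/
def elderCount : List α → ℕ
  | [] => 0
  | a :: l => (if ∃ b ∈ l, b < a then 1 else 0) + elderCount l

/-- A new maximum makes no other entry elder, and is itself elder unless it comes last. -/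
theorem elderCount_insertIdx (M : α) : ∀ (l : List α) (p : ℕ), (∀ a ∈ l, a < M) → p ≤ l.length →
    (l.insertIdx p M).elderCount = l.elderCount + if p < l.length then 1 else 0
  | [], 0, _, _ => by simp [elderCount]
  | a :: l, 0, h, _ => by
    have : ∃ b ∈ a :: l, b < M := ⟨a, by simp, h a (by simp)⟩
    rw [insertIdx_zero, elderCount, if_pos this, if_pos (by simp), add_comm]
  | a :: l, p + 1, h, hp => by
    have hp' : p ≤ l.length := by simpa using hp
    have hiff : (∃ b ∈ l.insertIdx p M, b < a) ↔ ∃ b ∈ l, b < a := by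
      have := h a (by simp)
      simp only [mem_insertIdx hp']
      constructor
      · rintro ⟨b, rfl | hb, hlt⟩
        · exact absurd this hlt.not_gt
        · exact ⟨b, hb, hlt⟩
      · rintro ⟨b, hb, hlt⟩
        exact ⟨b, .inr hb, hlt⟩
    rw [insertIdx_succ_cons, elderCount, elderCount,
      elderCount_insertIdx M l p (fun b hb => h b (by simp [hb])) hp']
    simp only [hiff, length_cons, Nat.add_lt_add_iff_right]
    omega

theorem Nodup.ncard_elder : ∀ {l : List α}, l.Nodup →
    {j | ∃ k, [j, k] <+ l ∧ k < j}.ncard = l.elderCount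
  | [], _ => by simp [elderCount]
  | a :: l, h => by
    rw [nodup_cons] at h
    have hfin : {j | ∃ k, [j, k] <+ l ∧ k < j}.Finite :=
      l.finite_toSet.subset fun j ⟨k, hk, _⟩ => hk.subset (by simp)
    have hnot : a ∉ {j | ∃ k, [j, k] <+ l ∧ k < j} :=
      fun ⟨k, hk, _⟩ => h.1 (hk.subset (by simp))
    have hsub : ∀ j k, [j, k] <+ a :: l ↔ (j = a ∧ k ∈ l) ∨ [j, k] <+ l := by
      intro j k
      rw [sublist_cons_iff]
      constructor
      · rintro (h | ⟨r, hr, h⟩)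
        · exact .inr h
        · simp only [cons.injEq] at hr
          obtain ⟨rfl, rfl⟩ := hr
          exact .inl ⟨rfl, singleton_sublist.1 h⟩
      · rintro (⟨rfl, hk⟩ | h)
        · exact .inr ⟨_, rfl, singleton_sublist.2 hk⟩
        · exact .inl h
    rw [elderCount, ← h.2.ncard_elder]
    split_ifs with hb
    · have : {j | ∃ k, [j, k] <+ a :: l ∧ k < j} =
          insert a {j | ∃ k, [j, k] <+ l ∧ k < j} := by
        ext j
        simp only [hsub, Set.mem_ofPred_eq, Set.mem_insert_iff]
        constructor
        · rintro ⟨k, ⟨rfl, -⟩ | hk, hlt⟩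
          · exact .inl rfl
          · exact .inr ⟨k, hk, hlt⟩
        · rintro (rfl | ⟨k, hk, hlt⟩)
          · obtain ⟨b, hb, hlt⟩ := hb
            exact ⟨b, .inl ⟨rfl, hb⟩, hlt⟩
          · exact ⟨k, .inr hk, hlt⟩
      rw [this, Set.ncard_insert_of_notMem hnot hfin, add_comm]
    · have : {j | ∃ k, [j, k] <+ a :: l ∧ k < j} = {j | ∃ k, [j, k] <+ l ∧ k < j} := by
        ext j
        simp only [hsub, Set.mem_ofPred_eq]
        constructor
        · rintro ⟨k, ⟨rfl, hk⟩ | hk, hlt⟩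
          · exact (hb ⟨k, hk, hlt⟩).elim
          · exact ⟨k, hk, hlt⟩
        · rintro ⟨k, hk, hlt⟩
          exact ⟨k, .inr hk, hlt⟩
      rw [this, zero_add]

theorem elderCount_le_length : ∀ l : List α, l.elderCount ≤ l.length
  | [] => le_rfl
  | a :: l => by
    have := elderCount_le_length l
    rw [elderCount, length_cons]
    split_ifs <;> omega

theorem insertIdx_length_append {α : Type*} (a : α) (l₂ : List α) : ∀ l₁ : List α,
    (l₁ ++ l₂).insertIdx l₁.length a = l₁ ++ a :: l₂
  | [] => by simp
  | b :: l₁ => by simp [insertIdx_length_append a l₂ l₁]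

theorem elderCount_map {β : Type*} [LinearOrder β] {f : α → β} (hf : StrictMono f) :
    ∀ l : List α, (l.map f).elderCount = l.elderCount
  | [] => rfl
  | a :: l => by simp [elderCount, elderCount_map hf l, hf.lt_iff_lt]

end List

/-! ### Growing child lists by inserting the largest label. -/

/-- The functions `c` for which `c i` lists the children of `i` in an increasing plane tree with
vertex set `{0, …, n - 1}`, if there are any vertices. -/
structure IsChildLists (n : ℕ) (c : ℕ → List ℕ) : Prop where
  nodup : ∀ i, (c i).Nodup
  lt : ∀ i, ∀ j ∈ c i, i < j
  lt_size : ∀ i, ∀ j ∈ c i, j < n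
  existsUnique : ∀ j, j ≠ 0 → j < n → ∃! i, j ∈ c i

/-- Insert `n` into the list `c v`, at position `p`. -/
def insertLeaf (n : ℕ) (c : ℕ → List ℕ) (v p : ℕ) : ℕ → List ℕ :=
  Function.update c v ((c v).insertIdx p n)

open Classical in
/-- The families of lists of children of all increasing plane trees with vertex set
`{0, …, n}`. -/
noncomputable def childLists : ℕ → Finset (ℕ → List ℕ)
  | 0 => {fun _ => []}
  | n + 1 => ((childLists n).sigma fun c => (Finset.range (n + 1)).sigma fun v =>
      Finset.range ((c v).length + 1)).image fun x => insertLeaf (n + 1) x.1 x.2.1 x.2.2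

theorem List.Nodup.insertIdx_of_notMem {α : Type*} {l : List α} (h : l.Nodup) {a : α} (ha : a ∉ l)
    {p : ℕ} (hp : p ≤ l.length) : (l.insertIdx p a).Nodup :=
  (List.perm_insertIdx a l hp).nodup_iff.2 (List.nodup_cons.2 ⟨ha, h⟩)

theorem IsChildLists.isChildLists_insertLeaf {n v p : ℕ} {c : ℕ → List ℕ} (h : IsChildLists n c) (hn : n ≠ 0)
    (hv : v < n) (hp : p ≤ (c v).length) : IsChildLists (n + 1) (insertLeaf n c v p) := by
  have hmem : ∀ i j, j ∈ insertLeaf n c v p i ↔ (i = v ∧ j = n) ∨ j ∈ c i := by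
    intro i j
    unfold insertLeaf
    by_cases hi : i = v
    · subst hi
      simp [List.mem_insertIdx hp]
    · simp [hi]
  have hnot : ∀ i, n ∉ c i := fun i hi => (h.lt_size i n hi).ne rfl
  refine ⟨fun i => ?_, fun i j hj => ?_, fun i j hj => ?_, fun j hj hjn => ?_⟩
  · unfold insertLeaf
    by_cases hi : i = v
    · subst hi
      simpa using (h.nodup i).insertIdx_of_notMem (hnot i) hp
    · simpa [Function.update_of_ne hi] using h.nodup i
  · rcases (hmem i j).1 hj with ⟨rfl, rfl⟩ | hj
    · exact hv
    · exact h.lt i j hj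
  · rcases (hmem i j).1 hj with ⟨rfl, rfl⟩ | hj
    · exact Nat.lt_succ_self _
    · exact (h.lt_size i j hj).trans (Nat.lt_succ_self _)
  · simp only [hmem]
    rcases (Nat.lt_succ_iff_lt_or_eq.1 hjn) with hlt | rfl
    · simpa [hlt.ne] using h.existsUnique j hj hlt
    · exact ⟨v, by simp, by simp [hnot]⟩

/-- The label `n` marks the insertion: its list gives `v`, its index gives `p`, and erasing it gives
back `c`. -/
theorem insertLeaf_inj {n v p v' p' : ℕ} {c c' : ℕ → List ℕ}
    (hc : IsChildLists n c) (hc' : IsChildLists n c')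
    (hp : p ≤ (c v).length) (hp' : p' ≤ (c' v').length)
    (h : insertLeaf n c v p = insertLeaf n c' v' p') : c = c' ∧ v = v' ∧ p = p' := by
  have hnot : ∀ i, n ∉ c i := fun i hi => (hc.lt_size i n hi).ne rfl
  have hnot' : ∀ i, n ∉ c' i := fun i hi => (hc'.lt_size i n hi).ne rfl
  have hv : v = v' := by
    by_contra hv
    have : n ∈ insertLeaf n c v p v := by simp [insertLeaf, List.mem_insertIdx hp]
    rw [h] at this
    simp [insertLeaf, Function.update_of_ne hv, hnot'] at this
  subst hv
  have hl : (c v).insertIdx p n = (c' v).insertIdx p' n := by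
    simpa [insertLeaf] using congrFun h v
  have hidx : ∀ (l : List ℕ) (q : ℕ), n ∉ l → q ≤ l.length → (l.insertIdx q n).idxOf n = q := by
    intro l q hl hq
    induction l generalizing q with
    | nil =>
      obtain rfl : q = 0 := by simpa using hq
      simp
    | cons a l ih =>
      cases q with
      | zero => simp
      | succ q =>
        simp only [List.mem_cons, not_or] at hl
        rw [List.insertIdx_succ_cons, List.idxOf_cons_ne _ (Ne.symm hl.1),
          ih q hl.2 (by simpa using hq)]
  have hpp : p = p' := by
    rw [← hidx (c v) p (hnot v) hp, hl, hidx (c' v) p' (hnot' v) hp']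
  subst hpp
  refine ⟨?_, rfl, rfl⟩
  funext i
  by_cases hi : i = v
  · subst hi
    rw [← List.eraseIdx_insertIdx_self (i := p) (l := c i) n, hl, List.eraseIdx_insertIdx_self]
  · simpa [insertLeaf, Function.update_of_ne hi] using congrFun h i

/-- Since children exceed their parents, the largest label `n` is a leaf, and deleting it leaves a
family of the smaller size. -/
theorem IsChildLists.exists_insertLeaf {n : ℕ} {c : ℕ → List ℕ} (hc : IsChildLists (n + 1) c)
    (hn : n ≠ 0) : ∃ c' v p, IsChildLists n c' ∧ v < n ∧ p ≤ (c' v).length ∧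
      insertLeaf n c' v p = c := by
  obtain ⟨v, hv, huv⟩ := hc.existsUnique n hn (Nat.lt_succ_self n)
  obtain ⟨l₁, l₂, hl⟩ := List.append_of_mem hv
  have hnd := hc.nodup v
  rw [hl] at hnd
  have hnot : n ∉ l₁ ++ l₂ := by
    have := List.nodup_middle.1 hnd
    exact (List.nodup_cons.1 this).1
  have hmem : ∀ i j, j ∈ Function.update c v (l₁ ++ l₂) i ↔ j ≠ n ∧ j ∈ c i := by
    intro i j
    by_cases hi : i = v
    · subst hi
      rw [Function.update_self, hl]
      by_cases hj : j = n
      · subst hj; simpa using hnot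
      · simp [hj]
    · rw [Function.update_of_ne hi]
      refine ⟨fun h => ⟨?_, h⟩, fun h => h.2⟩
      rintro rfl
      exact hi (huv i h)
  refine ⟨Function.update c v (l₁ ++ l₂), v, l₁.length, ⟨?_, ?_, ?_, ?_⟩, hc.lt v n hv, ?_, ?_⟩
  · intro i
    by_cases hi : i = v
    · subst hi
      simpa using (List.nodup_cons.1 (List.nodup_middle.1 hnd)).2
    · simpa [Function.update_of_ne hi] using hc.nodup i
  · exact fun i j hj => hc.lt i j ((hmem i j).1 hj).2
  · intro i j hj
    have := (hmem i j).1 hj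
    have := hc.lt_size i j this.2
    omega
  · intro j hj hjn
    simpa [hmem, hjn.ne] using hc.existsUnique j hj (by omega)
  · simp
  · funext i
    unfold insertLeaf
    by_cases hi : i = v
    · subst hi
      simp [hl, List.insertIdx_length_append]
    · simp [Function.update_of_ne hi]

theorem mem_childLists : ∀ {n : ℕ} {c : ℕ → List ℕ},
    c ∈ childLists n ↔ IsChildLists (n + 1) c
  | 0, c => by
    rw [childLists, Finset.mem_singleton]
    constructor
    · rintro rfl
      exact ⟨by simp, by simp, by simp, by omega⟩
    · intro h
      funext i
      refine List.eq_nil_iff_forall_not_mem.2 fun j hj => ?_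
      have := h.lt i j hj
      have := h.lt_size i j hj
      omega
  | n + 1, c => by
    simp only [childLists, Finset.mem_image, Finset.mem_sigma, Finset.mem_range, Sigma.exists,
      mem_childLists (n := n), Nat.lt_succ_iff (n := List.length _)]
    constructor
    · rintro ⟨c', v, p, ⟨h, hv, hp⟩, rfl⟩
      exact h.isChildLists_insertLeaf (Nat.succ_ne_zero n) hv hp
    · intro h
      obtain ⟨c', v, p, h', hv, hp, rfl⟩ := h.exists_insertLeaf (Nat.succ_ne_zero n)
      exact ⟨c', v, p, ⟨h', hv, hp⟩, rfl⟩

/-- The old and new terms stand on opposite sides to avoid subtraction in `ℕ`. -/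
theorem sum_update_range {n v : ℕ} (hv : v < n) (c : ℕ → List ℕ) (l : List ℕ) (f : List ℕ → ℕ) :
    ∑ i ∈ Finset.range n, f (Function.update c v l i) + f (c v) =
      ∑ i ∈ Finset.range n, f (c i) + f l := by
  have hv' := Finset.mem_range.2 hv
  rw [← Finset.add_sum_erase _ _ hv', ← Finset.add_sum_erase _ (fun i => f (c i)) hv',
    Finset.sum_congr rfl (fun i hi => by rw [Function.update_of_ne (Finset.ne_of_mem_erase hi)]),
    Function.update_self]
  ring

theorem IsChildLists.eq_nil {n i : ℕ} {c : ℕ → List ℕ} (hc : IsChildLists n c) (hi : n ≤ i + 1) :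
    c i = [] := by
  refine List.eq_nil_iff_forall_not_mem.2 fun j hj => ?_
  have := hc.lt i j hj
  have := hc.lt_size i j hj
  omega

/-- This counts edges: each inserted leaf adds one. -/
theorem sum_length_of_mem_childLists : ∀ {n : ℕ} {c : ℕ → List ℕ}, c ∈ childLists n →
    ∑ i ∈ Finset.range (n + 1), (c i).length = n
  | 0, c, h => by
    rw [mem_childLists] at h
    simp [h.eq_nil]
  | n + 1, c, h => by
    rw [mem_childLists] at h
    obtain ⟨c', v, p, h', hv, hp, rfl⟩ := h.exists_insertLeaf (Nat.succ_ne_zero n)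
    have ih := sum_length_of_mem_childLists (mem_childLists.2 h')
    have := sum_update_range hv c' ((c' v).insertIdx p (n + 1)) List.length
    rw [ih, List.length_insertIdx_of_le_length hp] at this
    rw [Finset.sum_range_succ, h.eq_nil le_rfl]
    simp only [insertLeaf, List.length_nil]
    omega

/-- The weight of a family of lists of children. -/
noncomputable def childListsWeight {R : Type*} [CommSemiring R] (x t : R) (n : ℕ)
    (c : ℕ → List ℕ) : R :=
  x ^ ((c 0).length - (c 0).elderCount) * t ^ ∑ i ∈ Finset.range n, (c i).elderCount

theorem childListsWeight_insertLeaf {R : Type*} [CommSemiring R] (x t : R) {n v p : ℕ}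
    {c : ℕ → List ℕ} (hc : IsChildLists n c) (hn : n ≠ 0) (hv : v < n) (hp : p ≤ (c v).length) :
    childListsWeight x t (n + 1) (insertLeaf n c v p) = childListsWeight x t n c *
      if p < (c v).length then t else if v = 0 then x else 1 := by
  have helder := (c v).elderCount_insertIdx n p (hc.lt_size v) hp
  have hsum := sum_update_range hv c ((c v).insertIdx p n) List.elderCount
  have hlen := List.length_insertIdx_of_le_length hp n
  have hle := (c 0).elderCount_le_length
  -- The range grows by the new vertex `n`, a leaf, which contributes nothing.
  have hlast : ∑ i ∈ Finset.range (n + 1), (insertLeaf n c v p i).elderCount =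
      ∑ i ∈ Finset.range n, (c i).elderCount + if p < (c v).length then 1 else 0 := by
    rw [Finset.sum_range_succ, (hc.isChildLists_insertLeaf hn hv hp).eq_nil le_rfl]
    simp only [insertLeaf, List.elderCount]
    omega
  have hzero : (insertLeaf n c v p 0).length - (insertLeaf n c v p 0).elderCount =
      (c 0).length - (c 0).elderCount +
        if p < (c v).length then 0 else if v = 0 then 1 else 0 := by
    by_cases h0 : v = 0
    · subst h0
      simp only [insertLeaf, Function.update_self, if_true]
      rw [hlen, helder]
      split_ifs <;> omega
    · simp [insertLeaf, Function.update_of_ne (Ne.symm h0), h0]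
  rw [childListsWeight, childListsWeight, hlast, hzero]
  split_ifs <;> ring

theorem sum_childListsWeight {R : Type*} [CommSemiring R] (x t : R) : ∀ n : ℕ,
    ∑ c ∈ childLists n, childListsWeight x t (n + 1) c =
      ∏ k ∈ Finset.range n, (x + (k : R) + (k : R) * t)
  | 0 => by simp [childLists, childListsWeight, List.elderCount]
  | n + 1 => by
    classical
    rw [Finset.prod_range_succ, ← sum_childListsWeight x t n, childLists, Finset.sum_image,
      Finset.sum_sigma, Finset.sum_mul]
    · refine Finset.sum_congr rfl fun c hc => ?_
      rw [Finset.sum_sigma]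
      have hv : ∀ v ∈ Finset.range (n + 1), ∑ p ∈ Finset.range ((c v).length + 1),
          childListsWeight x t (n + 2) (insertLeaf (n + 1) c v p) =
          childListsWeight x t (n + 1) c *
            ((c v).length * t + if v = 0 then x else 1) := by
        intro v hv
        rw [Finset.mem_range] at hv
        rw [Finset.sum_congr rfl fun p hp => childListsWeight_insertLeaf x t (mem_childLists.1 hc)
          (Nat.succ_ne_zero n) hv (Nat.lt_succ_iff.1 (Finset.mem_range.1 hp)), ← Finset.mul_sum,
          Finset.sum_range_succ, Finset.sum_congr rfl fun p hp => if_pos (Finset.mem_range.1 hp)]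
        simp
      -- The lengths add up to `n`; splitting off `v = 0`, which gives `x`, leaves `n` last
      -- positions of factor 1.
      rw [Finset.sum_congr rfl hv, ← Finset.mul_sum, Finset.sum_add_distrib, ← Finset.sum_mul,
        ← Nat.cast_sum, sum_length_of_mem_childLists hc, Finset.sum_range_succ']
      simp
      ring
    · rintro ⟨c, v, p⟩ h ⟨c', v', p'⟩ h' heq
      simp only [Finset.coe_sigma, Set.mem_sigma_iff, Finset.mem_coe, Finset.mem_range, mem_childLists,
        Nat.lt_succ_iff (n := List.length _)] at h h'
      obtain ⟨rfl, rfl, rfl⟩ := insertLeaf_inj h.1 h'.1 h.2.2 h'.2.2 heq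
      rfl

/-! ### Statistics of increasing plane trees. -/

namespace PlaneTree

section Statistics

variable {V : Type*}

theorem ext_children {S T : PlaneTree V} (h : ∀ i, S.children i = T.children i) : S = T := by
  refine PlaneTree.ext (RootedLabeledTree.ext_iff.1 ?_).1 (RootedLabeledTree.ext_iff.1 ?_).2
    (funext h)
  all_goals
    exact RootedLabeledTree.ext_isChild fun i j => by
      rw [← S.mem_children, ← T.mem_children, h]

variable [Fintype V] [LinearOrder V]

theorem imp_eq_zero_iff {T : PlaneTree V} : T.imp = 0 ↔ T.IsIncreasing := by
  rw [imp, Set.ncard_eq_zero (Set.toFinite _), Set.eq_empty_iff_forall_notMem]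
  constructor
  · refine fun h => RootedLabeledTree.isIncreasing_of_lt_of_isChild fun i j hij => ?_
    -- A child `k` with smallest `beta` cannot be elder, so its proper edge forces `i < T.beta k ≤
    -- T.beta j ≤ j`.
    obtain ⟨k, hk, hmin⟩ := Set.exists_min_image {k | T.IsChild i k} T.beta (Set.toFinite _)
      ⟨j, hij⟩
    have hy : ¬ T.IsElder k := by
      rintro ⟨m, ⟨i', hs⟩, hlt⟩
      have hk' : T.IsChild i' k := (T.mem_children _ _).1 (hs.subset (by simp))
      have hm : T.IsChild i' m := (T.mem_children _ _).1 (hs.subset (by simp))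
      obtain rfl := hk'.parent_unique hk
      exact (hmin m hm).not_gt hlt
    have hlt : i < T.beta k := by
      by_contra hlt
      exact h (i, k) ⟨hk, fun h' => h'.elim hy hlt⟩
    exact hlt.trans_le ((hmin j hij).trans (T.beta_le j))
  · rintro hT ⟨i, j⟩ ⟨hij, h⟩
    exact h (.inr (by simpa only [hT.beta_eq] using hT.lt_of_isChild hij))

theorem isElder_iff {T : PlaneTree V} (hT : T.IsIncreasing) {j : V} :
    T.IsElder j ↔ ∃ i, ∃ k, [j, k].Sublist (T.children i) ∧ k < j := by
  simp only [IsElder, IsRightBrother, hT.beta_eq]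
  constructor
  · rintro ⟨k, ⟨i, h⟩, hlt⟩
    exact ⟨i, k, h, hlt⟩
  · rintro ⟨i, k, h, hlt⟩
    exact ⟨k, ⟨i, h⟩, hlt⟩

theorem eld_eq {T : PlaneTree V} (hT : T.IsIncreasing) :
    T.eld = ∑ i, (T.children i).elderCount := by
  have hset : {j | T.IsElder j} = ⋃ i, {j | ∃ k, [j, k].Sublist (T.children i) ∧ k < j} := by
    ext j
    simp [isElder_iff hT]
  rw [eld, hset, Set.ncard_iUnion_of_finite (fun _ => Set.toFinite _), finsum_eq_sum_of_fintype]
  · exact Finset.sum_congr rfl fun i _ => (T.nodup_children i).ncard_elder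
  · intro i i' hne
    refine Set.disjoint_left.2 ?_
    rintro j ⟨k, hk, -⟩ ⟨k', hk', -⟩
    have hj : T.IsChild i j := (T.mem_children _ _).1 (hk.subset (by simp))
    exact hne (hj.parent_unique ((T.mem_children _ _).1 (hk'.subset (by simp))))

theorem young_eq {T : PlaneTree V} (hT : T.IsIncreasing) (v : V) :
    T.young v = (T.children v).length - (T.children v).elderCount := by
  have hset : {j | T.IsChild v j ∧ ¬ T.IsElder j} =
      {j | j ∈ T.children v} \ {j | ∃ k, [j, k].Sublist (T.children v) ∧ k < j} := by
    ext j
    simp only [Set.mem_ofPred_eq, Set.mem_sdiff, T.mem_children]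
    refine and_congr_right fun hj => not_congr ?_
    rw [isElder_iff hT]
    constructor
    · rintro ⟨i, k, h, hlt⟩
      obtain rfl := ((T.mem_children _ _).1 (h.subset (by simp))).parent_unique hj
      exact ⟨k, h, hlt⟩
    · exact fun h => ⟨v, h⟩
  have hcard : {j | j ∈ T.children v}.ncard = (T.children v).length := by
    classical
    rw [← List.toFinset_card_of_nodup (T.nodup_children v), ← Set.ncard_coe_finset,
      List.coe_toFinset]
  have hsub : {j | ∃ k, [j, k].Sublist (T.children v) ∧ k < j} ⊆ {j | j ∈ T.children v} :=
    fun j ⟨k, hk, _⟩ => hk.subset (by simp)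
  rw [young, hset, Set.ncard_sdiff hsub (Set.toFinite _), (T.nodup_children v).ncard_elder, hcard]

theorem eld_eq_zero_iff {T : PlaneTree V} (hT : T.IsIncreasing) :
    T.eld = 0 ↔ ∀ i, (T.children i).Pairwise (· ≤ ·) := by
  rw [eld, Set.ncard_eq_zero (Set.toFinite _), Set.eq_empty_iff_forall_notMem]
  simp only [Set.mem_ofPred_eq, isElder_iff hT, List.pairwise_iff_forall_sublist]
  constructor
  · exact fun h i a b hs => not_lt.1 fun hlt => h a ⟨i, b, hs, hlt⟩
  · rintro h j ⟨i, k, hs, hlt⟩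
    exact (h i hs).not_gt hlt

/-- A rooted tree underlies exactly one plane tree in which the children of each vertex are sorted
in increasing order. -/
theorem existsUnique_pairwise_le (T : RootedLabeledTree V) :
    ∃! S : PlaneTree V, S.toRootedLabeledTree = T ∧ ∀ i, (S.children i).Pairwise (· ≤ ·) := by
  classical
  refine ⟨⟨T, fun i => (Finset.univ.filter fun j => T.IsChild i j).sort (· ≤ ·),
    fun i => Finset.sort_nodup _ _, fun i j => by simp⟩,
    ⟨rfl, fun i => Finset.pairwise_sort _ _⟩, ?_⟩
  rintro S ⟨rfl, hS⟩
  refine ext_children fun i => ?_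
  refine List.Perm.eq_of_pairwise (le := (· ≤ ·)) (fun a b _ _ => le_antisymm) (hS i)
    (Finset.pairwise_sort _ _) ?_
  rw [List.perm_ext_iff_of_nodup (S.nodup_children i) (Finset.sort_nodup _ _)]
  simp [S.mem_children]

/-- Having no elder vertex means that all lists of children are sorted, so the plane structure
carries no information. -/
theorem card_isIncreasing_eq :
    Nat.card {T : RootedLabeledTree V // T.IsIncreasing} =
      Nat.card {T : PlaneTree V // T.IsIncreasing ∧ T.eld = 0} := by
  symm
  refine Nat.card_eq_of_bijective (fun S => ⟨S.1.toRootedLabeledTree, S.2.1⟩) ⟨?_, ?_⟩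
  · rintro ⟨S, hS, hS0⟩ ⟨S', hS', hS0'⟩ h
    simp only [Subtype.mk.injEq] at h ⊢
    exact (existsUnique_pairwise_le S'.toRootedLabeledTree).unique
      ⟨h, (eld_eq_zero_iff hS).1 hS0⟩ ⟨rfl, (eld_eq_zero_iff hS').1 hS0'⟩
  · rintro ⟨T, hT⟩
    obtain ⟨S, ⟨rfl, hS⟩, -⟩ := existsUnique_pairwise_le T
    exact ⟨⟨S, hT, (eld_eq_zero_iff hT).2 hS⟩, rfl⟩

end Statistics

/-! ### Encoding plane trees by lists of natural numbers. -/

variable {n : ℕ}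

/-- The lists of children of the vertices of a plane tree, as lists of natural numbers. -/
def natChildren (T : PlaneTree (Fin n)) (i : ℕ) : List ℕ :=
  if h : i < n then (T.children ⟨i, h⟩).map Fin.val else []

theorem natChildren_val (T : PlaneTree (Fin n)) (i : Fin n) :
    T.natChildren i = (T.children i).map Fin.val := by
  simp [natChildren]

theorem natChildren_injective : Function.Injective (natChildren (n := n)) := by
  intro S T h
  refine ext_children fun i => ?_
  have := congrFun h i
  rw [natChildren_val, natChildren_val] at this
  exact List.map_injective_iff.2 Fin.val_injective this

theorem mem_natChildren {T : PlaneTree (Fin n)} {i j : ℕ} :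
    j ∈ T.natChildren i ↔ ∃ (hi : i < n) (hj : j < n), T.IsChild ⟨i, hi⟩ ⟨j, hj⟩ := by
  unfold natChildren
  split_ifs with hi
  · simp only [List.mem_map, T.mem_children, hi, exists_true_left]
    constructor
    · rintro ⟨k, hk, rfl⟩
      exact ⟨k.2, hk⟩
    · rintro ⟨hj, h⟩
      exact ⟨_, h, rfl⟩
  · simp [hi]

theorem root_eq_zero [NeZero n] {T : RootedLabeledTree (Fin n)} (hT : T.IsIncreasing) :
    T.root = 0 := by
  obtain ⟨p, hp⟩ := T.isTree.connected.exists_isPath T.root 0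
  exact le_antisymm (hT.le_of_isDescendant ⟨p, hp, p.start_mem_support⟩) (Fin.zero_le _)

theorem isChildLists_natChildren [NeZero n] {T : PlaneTree (Fin n)} (hT : T.IsIncreasing) :
    IsChildLists n T.natChildren := by
  refine ⟨fun i => ?_, fun i j h => ?_, fun i j h => ?_, fun j hj hjn => ?_⟩
  · unfold natChildren
    split_ifs with hi
    · exact (T.nodup_children _).map Fin.val_injective
    · exact List.nodup_nil
  · obtain ⟨hi, hj, h⟩ := mem_natChildren.1 h
    exact hT.lt_of_isChild h
  · obtain ⟨hi, hj, h⟩ := mem_natChildren.1 h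
    exact hj
  · have hne : (⟨j, hjn⟩ : Fin n) ≠ T.root := by
      rw [root_eq_zero hT]
      exact fun h => hj (congrArg Fin.val h)
    obtain ⟨i, hi⟩ := T.exists_isChild hne
    refine ⟨i, mem_natChildren.2 ⟨i.2, hjn, hi⟩, fun k hk => ?_⟩
    obtain ⟨hk, _, hkj⟩ := mem_natChildren.1 hk
    exact congrArg Fin.val (hkj.parent_unique hi)

theorem exists_natChildren_eq [NeZero n] {c : ℕ → List ℕ} (hc : IsChildLists n c) :
    ∃ T : PlaneTree (Fin n), T.IsIncreasing ∧ T.natChildren = c := by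
  have hlift : ∀ i, ∃ l : List (Fin n), l.map Fin.val = c i := by
    intro i
    lift c i to List (Fin n) using hc.lt_size i with l
    exact ⟨l, rfl⟩
  choose l hl using hlift
  have hmem : ∀ (i : ℕ) (j : Fin n), j ∈ l i ↔ (j : ℕ) ∈ c i := by
    intro i j
    rw [← hl, List.mem_map_of_injective Fin.val_injective]
  have hlt : ∀ i j : Fin n, j ∈ l i → i < j := fun i j h => hc.lt i j ((hmem _ _).1 h)
  obtain ⟨T, hT⟩ := RootedLabeledTree.exists_isChild_iff (0 : Fin n) (fun i j => j ∈ l i) hlt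
    (fun i h => absurd (hlt i 0 h) (Fin.zero_le i).not_gt) (by
      intro j hj
      obtain ⟨i, hi, hu⟩ := hc.existsUnique j (fun h => hj (Fin.ext h)) j.2
      have hin : i < n := (hc.lt i j hi).trans j.2
      exact ⟨⟨i, hin⟩, (hmem _ _).2 hi, fun k hk => Fin.ext (hu k ((hmem _ _).1 hk))⟩)
  refine ⟨⟨T, fun i => l i, fun i => ?_, fun i j => (hT i j).symm⟩,
    RootedLabeledTree.isIncreasing_of_lt_of_isChild fun i j h => hlt i j ((hT i j).1 h), ?_⟩
  · exact List.Nodup.of_map Fin.val (by rw [hl]; exact hc.nodup i)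
  · funext i
    unfold natChildren
    split_ifs with hi
    · exact hl i
    · exact (hc.eq_nil (by omega)).symm

theorem weight_eq {R : Type*} [CommSemiring R] (x t : R) [NeZero n] {T : PlaneTree (Fin n)}
    (hT : T.IsIncreasing) :
    x ^ T.young 0 * t ^ T.eld = childListsWeight x t n T.natChildren := by
  have h0 := T.natChildren_val 0
  rw [Fin.val_zero] at h0
  rw [childListsWeight, young_eq hT, eld_eq hT, Finset.sum_range, h0, List.length_map,
    List.elderCount_map Fin.val_strictMono]
  simp only [natChildren_val, List.elderCount_map Fin.val_strictMono]

end PlaneTree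

/-! ### The generating function and its specialisations. -/

theorem mem_planeTrees_zero {n : ℕ} {T : PlaneTree (Fin n)} :
    T ∈ planeTrees n 0 ↔ T.IsIncreasing := by
  simp [planeTrees, PlaneTree.imp_eq_zero_iff]

theorem sum_planeTrees_zero {R : Type*} [CommSemiring R] (x t : R) (n : ℕ) :
    ∑ T ∈ planeTrees (n + 1) 0, x ^ T.young 0 * t ^ T.eld =
      ∏ k ∈ Finset.range n, (x + (k : R) + (k : R) * t) := by
  rw [← sum_childListsWeight]
  refine Finset.sum_bij (fun T _ => T.natChildren) (fun T hT => ?_)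
    (fun S _ T _ h => PlaneTree.natChildren_injective h) (fun c hc => ?_)
    (fun T hT => PlaneTree.weight_eq x t (mem_planeTrees_zero.1 hT))
  · exact mem_childLists.2 (PlaneTree.isChildLists_natChildren (mem_planeTrees_zero.1 hT))
  · obtain ⟨T, hT, rfl⟩ := PlaneTree.exists_natChildren_eq (mem_childLists.1 hc)
    exact ⟨T, mem_planeTrees_zero.2 hT, rfl⟩

theorem card_increasing_rootedLabeledTree (n : ℕ) :
    Nat.card {T : RootedLabeledTree (Fin (n + 1)) // T.IsIncreasing} = n.factorial := by
  classical
  -- At `t = 0` the weight `0 ^ T.eld` is the indicator of `T.eld = 0`.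
  have h := sum_planeTrees_zero (1 : ℕ) 0 n
  simp only [one_pow, one_mul, mul_zero, add_zero, Nat.cast_id] at h
  rw [← Finset.prod_range_add_one_eq_factorial, Finset.prod_congr rfl fun k _ => add_comm k 1, ← h,
    PlaneTree.card_isIncreasing_eq, Nat.subtype_card _ (fun T => Finset.mem_filter_univ T),
    Finset.card_filter]
  simp only [planeTrees, PlaneTree.imp_eq_zero_iff, Finset.sum_filter, zero_pow_eq, ite_and]

theorem card_increasing_planeTree (n : ℕ) :
    Nat.card {T : PlaneTree (Fin (n + 1)) // T.IsIncreasing} =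
      Nat.doubleFactorial (2 * (n + 1) - 3) := by
  have h := sum_planeTrees_zero (1 : ℕ) 1 n
  simp only [one_pow, mul_one, Nat.cast_id, Finset.sum_const, smul_eq_mul] at h
  have hprod : ∀ n : ℕ, ∏ k ∈ Finset.range n, (1 + k + k) =
      Nat.doubleFactorial (2 * (n + 1) - 3) := by
    intro n
    induction n with
    | zero => rfl
    | succ n ih =>
      rw [Finset.prod_range_succ, ih]
      -- At `n = 0` the subtraction `2 * (n + 1) - 3` truncates to 0, so the recursion in steps of
      -- two starts only at `n = 1`.
      cases n with
      | zero => rfl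
      | succ n =>
        rw [show 2 * (n + 1 + 1 + 1) - 3 = (2 * (n + 1 + 1) - 3) + 2 by omega,
          Nat.doubleFactorial_add_two, mul_comm]
        congr 1
        omega
  rw [← hprod, ← h, ← Nat.card_eq_finsetCard]
  simp only [mem_planeTrees_zero]

theorem proposition2p4 (n : ℕ) (hn : 1 ≤ n) :
    (∀ {R : Type*} [CommSemiring R] (x t : R),
      ∑ T ∈ planeTrees n 0, x ^ T.young (⟨0, hn⟩ : Fin n) * t ^ T.eld
        = ∏ k ∈ Finset.range (n - 1), (x + (k : R) + (k : R) * t)) ∧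
    Nat.card {T : RootedLabeledTree (Fin n) // T.IsIncreasing} = Nat.factorial (n - 1) ∧
    Nat.card {T : PlaneTree (Fin n) // T.IsIncreasing} = Nat.doubleFactorial (2 * n - 3) := by
  obtain ⟨n, rfl⟩ := Nat.exists_eq_add_of_le' hn
  exact ⟨fun x t => sum_planeTrees_zero x t n, card_increasing_rootedLabeledTree n,
    card_increasing_planeTree n⟩
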